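/- Throughout, graphs are finite, simple and nonempty, and $\mathbb{N}=\{1,2,3,\dots\}$. A \emph{cover} of a graph $G$ is a pair $\mathcal H=(L,H)$, where $H$ is a graph and $L$ assigns to each $u\in V(G)$ a set $L(u)\subseteq V(H)$, such that: (1) the sets $L(u)$, $u\in V(G)$, partition $V(H)$; (2) $H[L(u)]$ is complete for every $u\in V(G)$; (3) if $H$ has an edge between $L(u)$ and $L(v)$, then $u=v$ or $uv\in E(G)$; (4) if $uv\in E(G)$, then the edges of $H$ between $L(u)$ and $L(v)$ form a (possibly empty) matching. The cover is \emph{$m$-fold} if $|L(u)|=m$ for every $u\in V(G)$. An \emph{$\mathcal H$-coloring} of $G$ is an independent set of size $|V(G)|$ in $H$; let $P_{DP}(G,\mathcal H)$ be the number of $\mathcal H$-colorings of $G$. The \emph{DP color function} $P_{DP}(G,m)$ is the minimum of $P_{DP}(G,\mathcal H)$ over all $m$-fold covers $\mathcal H$ of $G$, and $P(G,m)$ is the number of proper colorings $V(G)\to\{1,\dots,m\}$ of $G$. The \emph{generalized Theta graph} $\Theta(l_1,\dots,l_k)$, with $l_1,\dots,l_k\in\mathbb{N}$, consists of two distinct end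 vertices joined by $k$ internally disjoint paths of lengths $l_1,\dots,l_k$ (in edges). \textbf{Theorem.} Let $G=\Theta(l_1,\dots,l_k)$, where $k\ge 2$, $l_1,\dots,l_k\in\mathbb{N}$, $l_2\le\cdots\le l_k$ and $l_2\ge\max\{l_1,2\}$. (i) If there is a $j\in\{2,\dots,k\}$ such that $l_1$ and $l_j$ have the same parity, then there is an $N\in\mathbb{N}$ such that $P_{DP}(G,m)<P(G,m)$ for all $m\ge N$. (ii) If $l_1$ and $l_j$ have different parity for each $j\in\{2,\dots,k\}$, then there is an $N\in\mathbb{N}$ such that $P_{DP}(G,m)=P(G,m)$ for all $m\ge N$. -/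

import Mathlib

/-- A cover `(L, H)` of a graph `G`, where the graph `H` has vertex type `W` and
`L` assigns to every vertex of `G` a finite set of vertices of `H`. -/
structure DPCover {V : Type*} (G : SimpleGraph V) (W : Type*) where
  /-- the graph `H` -/
  H : SimpleGraph W
  /-- the lists `L(v)` -/
  L : V → Finset W
  /-- the lists are pairwise disjoint ... -/
  disjoint_L : ∀ u v, u ≠ v → Disjoint (L u) (L v)
  /-- ... and their union is the vertex set of `H` -/
  exists_mem_L : ∀ x, ∃ v, x ∈ L v
  /-- every list induces a complete subgraph of `H` -/
  isClique_L : ∀ v, H.IsClique (L v : Set W)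
  /-- an edge of `H` between `L(u)` and `L(v)` forces `u = v` or `uv ∈ E(G)` -/
  eq_or_adj : ∀ u v, ∀ x ∈ L u, ∀ y ∈ L v, H.Adj x y → u = v ∨ G.Adj u v
  /-- for `uv ∈ E(G)`, the edges of `H` between `L(u)` and `L(v)` form a matching: a vertex of
  `L(u)` has at most one neighbour in `L(v)` (and vice versa, as `u` and `v` may be exchanged) -/
  matching : ∀ u v, G.Adj u v → ∀ x ∈ L u, ∀ y ∈ L v, ∀ y' ∈ L v,
    H.Adj x y → H.Adj x y' → y = y'

/-- A cover is `m`-fold if every list has exactly `m` elements. -/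
def DPCover.IsFold {V W : Type*} {G : SimpleGraph V} (C : DPCover G W) (m : ℕ) : Prop :=
  ∀ v, (C.L v).card = m

/-- An `ℋ`-coloring for a cover `ℋ = (L, H)` of `G`: an independent set of `H` of size `|V(G)|`. -/
def DPCover.IsColoring {V W : Type*} [Fintype V] {G : SimpleGraph V} (C : DPCover G W)
    (I : Finset W) : Prop :=
  C.H.IsIndepSet (I : Set W) ∧ I.card = Fintype.card V

/-- `P_DP(G, ℋ)`, the number of `ℋ`-colorings of `G`. -/
noncomputable def DPCover.numColorings {V W : Type*} [Fintype V] {G : SimpleGraph V}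
    (C : DPCover G W) : ℕ :=
  Nat.card {I : Finset W // C.IsColoring I}

/-- The DP color function `P_DP(G, m)`: the minimum of `P_DP(G, ℋ)` over all `m`-fold covers `ℋ`
of `G`. As `G` is finite, so is the graph of every cover of `G`, and it is enough to let its vertex
type range over `Type`. The set of values is never empty, see `exists_isFold`. -/
noncomputable def dpColorFunction {V : Type*} [Fintype V] (G : SimpleGraph V) (m : ℕ) : ℕ :=
  sInf {n : ℕ | ∃ (W : Type) (C : DPCover G W), C.IsFold m ∧ C.numColorings = n}

/-- Every finite graph has an `m`-fold cover, so the minimum in `dpColorFunction` is attained. -/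
theorem exists_isFold {V : Type*} [Fintype V] (G : SimpleGraph V) (m : ℕ) :
    ∃ (W : Type) (C : DPCover G W), C.IsFold m := by
  classical
  let e := Fintype.equivFin V
  refine ⟨Fin (Fintype.card V) × Fin m,
    { H := SimpleGraph.fromRel fun x y => x.1 = y.1
      L := fun v => Finset.univ.filter fun x => x.1 = e v
      disjoint_L := ?_
      exists_mem_L := fun x => ⟨e.symm x.1, by simp⟩
      isClique_L := ?_
      eq_or_adj := ?_
      matching := ?_ }, ?_⟩
  · intro u v huv
    rw [Finset.disjoint_left]
    intro x hx hy
    simp only [Finset.mem_filter, Finset.mem_univ, true_and] at hx hy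
    exact huv (e.injective (hx.symm.trans hy))
  · intro v x hx y hy hxy
    simp at hx hy
    simp [SimpleGraph.fromRel_adj, hxy, hx, hy]
  · intro u v x hx y hy h
    simp only [Finset.mem_filter, Finset.mem_univ, true_and] at hx hy
    simp only [SimpleGraph.fromRel_adj, hx, hy] at h
    left
    rcases h.2 with h | h
    · exact e.injective h
    · exact (e.injective h).symm
  · intro u v huv x hx y hy y' _ h _
    simp only [Finset.mem_filter, Finset.mem_univ, true_and] at hx hy
    simp only [SimpleGraph.fromRel_adj, hx, hy] at h
    exfalso
    rcases h.2 with h | h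
    · exact huv.ne (e.injective h)
    · exact huv.ne (e.injective h).symm
  · intro v
    have : (Finset.univ.filter fun x : Fin (Fintype.card V) × Fin m => x.1 = e v)
        = {e v} ×ˢ Finset.univ := by
      ext x; simp only [Finset.mem_filter, Finset.mem_univ, true_and, Finset.mem_product,
        Finset.mem_singleton, and_true]
    change (Finset.univ.filter fun x : Fin (Fintype.card V) × Fin m => x.1 = e v).card = m
    rw [this]; simp

/-- `P(G, m)`, the value of the chromatic polynomial at `m`: the number of proper `m`-colorings. -/
noncomputable def chromaticCount {V : Type*} (G : SimpleGraph V) (m : ℕ) : ℕ :=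
  Nat.card (G.Coloring (Fin m))

/-- Vertices of the generalized Theta graph with path lengths `l`: two end vertices
(`Sum.inl false` and `Sum.inl true`) and `l i - 1` internal vertices on the `i`-th path. -/
abbrev ThetaVertex {k : ℕ} (l : Fin k → ℕ) : Type :=
  Bool ⊕ (Σ i : Fin k, Fin (l i - 1))

/-- The `j`-th vertex of the `i`-th path, for `0 ≤ j ≤ l i`: the first end vertex for `j = 0`, the
internal vertices for `0 < j < l i`, and the second end vertex for `j = l i`. -/
def thetaPathVertex {k : ℕ} (l : Fin k → ℕ) (i : Fin k) (j : ℕ) : ThetaVertex l :=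
  if j = 0 then Sum.inl false
  else if h : j - 1 < l i - 1 then Sum.inr ⟨i, ⟨j - 1, h⟩⟩
  else Sum.inl true

/-- The generalized Theta graph `Θ(l 0, …, l (k - 1))`: two end vertices joined by `k` internally
disjoint paths of lengths `l i ≥ 1`. The edges are the pairs of consecutive vertices of the paths. -/
def generalizedTheta {k : ℕ} (l : Fin k → ℕ) : SimpleGraph (ThetaVertex l) :=
  SimpleGraph.fromRel fun x y =>
    ∃ i : Fin k, ∃ j < l i, x = thetaPathVertex l i j ∧ y = thetaPathVertex l i (j + 1)

/-! Completing every matching of a cover to a permutation only removes colorings, so it suffices to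
study colorings twisted by permutations on the edges. A path with `n` edges and prescribed end
colors has `c_n` twisted colorings, or `c_n + (-1)^n` if the end colors correspond under the
composite permutation. With `x_i = (-1)^(l i) / c_(l i)` and composites `π_i`, the total is `∏ c_(l
i)` times `∑ a, ∑ b, ∏ i, (1 + x_i [b = π_i a])` (`card_twistedThetaColoring`); all `π_i = 1` gives
`P(G, m)`.

For fixed `a`, the inner sum is `m` plus the sum of `∏ (1 + x_i) - 1` over the classes of paths with
equal `π_i a`. Merging two classes with products `P` and `Q` changes it by `(P - 1) * (Q - 1)`. As
`c_n` grows at least by the factor `m - 2`, for large `m` the shortest path decides the sign of `P -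
1` for every class containing it (`sign_prod_pathDeviation`). If all other paths have the opposite
parity, merging everything into its class is optimal, so the untwisted cover is a minimum. If path
`j` has the same parity, separating it from the rest, whose product is `Q`, lowers the sum by `x_j *
(Q - 1) > 0`. -/

/-! ### Sums of products of factors close to 1 -/

/-- A product of factors `1 + x i`, one of which deviates from `1` by much more than the others do
in the opposite direction, lies on the same side of `1` as that factor. -/
theorem sign_mul_prod_one_add_sub_one_pos {ι : Type*} [DecidableEq ι] (x : ι → ℚ) (ε δ : ℚ)
    (hε : ε = 1 ∨ ε = -1) (s : Finset ι) (i₀ : ι) (hi₀ : i₀ ∈ s) (hδ : 0 ≤ δ)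
    (hx₀ : 0 < ε * x i₀) (hle : ∀ i, |x i| ≤ 1) (hsδ : 2 * (s.card * δ) < ε * x i₀)
    (hx : ∀ i, -δ ≤ ε * x i) :
    0 < ε * (∏ i ∈ s, (1 + x i) - 1) := by
  have hnn : ∀ i, 0 ≤ 1 + x i := fun i => by linarith [(abs_le.1 (hle i)).1]
  have hx1 := abs_le.1 (hle i₀)
  have hcard : (s.erase i₀).card + 1 = s.card := Finset.card_erase_add_one hi₀
  have hc : ((s.erase i₀).card : ℚ) * δ ≤ s.card * δ := by
    rw [← hcard]; push_cast; nlinarith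
  have hδ1 : δ ≤ 1 := by
    have h1 : (1 : ℚ) ≤ s.card := by exact_mod_cast Finset.card_pos.2 ⟨i₀, hi₀⟩
    have h2 : ε * x i₀ ≤ 1 := by rcases hε with h | h <;> rw [h] <;> linarith
    nlinarith
  have hbern := one_add_mul_le_pow (a := -δ) (by linarith) (s.erase i₀).card
  rw [← Finset.mul_prod_erase s _ hi₀]
  rcases hε with rfl | rfl
  · have h : (1 + -δ) ^ (s.erase i₀).card ≤ ∏ i ∈ s.erase i₀, (1 + x i) := by
      rw [← Finset.prod_const]
      exact Finset.prod_le_prod (fun i _ => by linarith) fun i _ => by linarith [hx i]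
    have := mul_le_mul_of_nonneg_left (hbern.trans h) (hnn i₀)
    nlinarith
  · have h : ∏ i ∈ s.erase i₀, (1 + x i) ≤ (1 + δ) ^ (s.erase i₀).card := by
      rw [← Finset.prod_const]
      exact Finset.prod_le_prod (fun i _ => hnn i) fun i _ => by linarith [hx i]
    -- Together with Bernoulli for `1 - δ`, this bounds `(1 + δ) ^ n` by the inverse of `1 - n * δ`,
    -- which exceeds `1 + x i₀`.
    have h1 : (1 + δ) ^ (s.erase i₀).card * (1 + -δ) ^ (s.erase i₀).card ≤ 1 := by
      rw [← mul_pow]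
      exact pow_le_one₀ (by nlinarith) (by nlinarith)
    have hp : 0 < (1 + δ) ^ (s.erase i₀).card := by positivity
    have h2 := mul_le_mul_of_nonneg_left h (hnn i₀)
    have h3 := (mul_le_mul_of_nonneg_left hbern hp.le).trans h1
    have h4 : (1 + x i₀) * (1 + δ) ^ (s.erase i₀).card <
        (1 + δ) ^ (s.erase i₀).card * (1 + (s.erase i₀).card * -δ) := by
      rw [mul_comm]
      exact mul_lt_mul_of_pos_left (by linarith) hp
    linarith

/-- Merging all classes of a partition of the factors into one decreases the sum of the products,
if the class of `i₀` always lies on one side of `1` and all other factors on the other side. -/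
theorem sum_prod_ite_const_le {ι α : Type*} [Fintype ι] [DecidableEq ι] [Fintype α]
    [DecidableEq α] (x : ι → ℚ) (ε : ℚ) (hε : ε = 1 ∨ ε = -1) (i₀ : ι)
    (hsign : ∀ s : Finset ι, i₀ ∈ s → 0 < ε * (∏ i ∈ s, (1 + x i) - 1))
    (hle : ∀ i, |x i| ≤ 1) (hx : ∀ i, i ≠ i₀ → ε * x i ≤ 0) (g : ι → α) (a : α) :
    ∑ b, ∏ i, (1 + x i * if b = a then 1 else 0) ≤
      ∑ b, ∏ i, (1 + x i * if b = g i then 1 else 0) := by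
  -- The classes are absorbed one at a time into the class of `i₀`.
  have key : ∀ U : Finset α, g i₀ ∉ U →
      ∏ i with g i ∈ insert (g i₀) U, (1 + x i) - 1 ≤
        ∑ b ∈ insert (g i₀) U, (∏ i with g i = b, (1 + x i) - 1) := by
    intro U
    induction U using Finset.induction_on with
    | empty => intro _; simp
    | insert b U hb ih =>
      intro hU
      rw [Finset.mem_insert, not_or] at hU
      have hb' : b ∉ insert (g i₀) U := by
        rw [Finset.mem_insert, not_or]; exact ⟨fun h => hU.1 h.symm, hb⟩
      rw [Finset.insert_comm, Finset.sum_insert hb']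
      have hsplit : ∏ i with g i ∈ insert b (insert (g i₀) U), (1 + x i) =
          (∏ i with g i = b, (1 + x i)) * ∏ i with g i ∈ insert (g i₀) U, (1 + x i) := by
        rw [← Finset.prod_union]
        · congr 1; ext i; simp
        · rw [Finset.disjoint_left]
          intro i hi hi'
          simp only [Finset.mem_filter, Finset.mem_univ, true_and] at hi hi'
          exact hb' (hi ▸ hi')
      rw [hsplit]
      have h1 := hsign (Finset.univ.filter fun i => g i ∈ insert (g i₀) U) (by simp)
      have hne : ∀ i, g i = b → i ≠ i₀ := fun i hi h => hU.1 (by rw [← hi, h])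
      have h2 : ε * (∏ i with g i = b, (1 + x i) - 1) ≤ 0 := by
        rcases hε with rfl | rfl
        · have := Finset.prod_le_one (s := Finset.univ.filter fun i => g i = b)
            (f := fun i => 1 + x i) (fun i _ => by linarith [(abs_le.1 (hle i)).1])
            (fun i hi => by linarith [hx i (hne i (Finset.mem_filter.1 hi).2)])
          linarith
        · have := Finset.one_le_prod (s := Finset.univ.filter fun i => g i = b)
            (f := fun i => 1 + x i)
            (fun i hi => by linarith [hx i (hne i (Finset.mem_filter.1 hi).2)])
          linarith
      have ih := ih hU.2
      -- The two merged products lie on opposite sides of 1, so `(P - 1) * (Q - 1) ≤ 0`.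
      rcases hε with rfl | rfl <;> nlinarith
  have h := key (Finset.univ.erase (g i₀)) (by simp)
  rw [Finset.insert_erase (Finset.mem_univ _)] at h
  have e : ∀ b (f : ι → α), ∏ i, (1 + x i * if b = f i then 1 else 0) =
      ∏ i with f i = b, (1 + x i) := by
    intro b f
    rw [Finset.prod_filter]
    refine Finset.prod_congr rfl fun i _ => ?_
    by_cases hb : f i = b
    · simp [hb]
    · simp [hb, Ne.symm hb]
  have e' : ∀ b, ∏ i, (1 + x i * if b = a then 1 else 0) =
      1 + if b = a then ∏ i, (1 + x i) - 1 else 0 := by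
    intro b; by_cases hb : b = a <;> simp [hb]
  simp only [e', Finset.sum_add_distrib, Finset.sum_ite_eq', Finset.mem_univ, if_true]
  simp only [Finset.sum_sub_distrib, Finset.mem_univ, Finset.filter_true] at h
  simp only [e]
  linarith

/-- Separating `j` from the other factors, with product `Q`, replaces `(1 + x j) * Q - 1` by `x j +
(Q - 1)`; the difference is exactly `x j * (Q - 1)`. -/
theorem sum_prod_ite_update_lt {ι α : Type*} [Fintype ι] [DecidableEq ι] [Fintype α]
    [DecidableEq α] (x : ι → ℚ) (j : ι)
    (hpos : 0 < x j * (∏ i ∈ Finset.univ.erase j, (1 + x i) - 1)) (a c : α) (hac : c ≠ a) :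
    ∑ b, ∏ i, (1 + x i * if b = Function.update (fun _ => a) j c i then 1 else 0) <
      ∑ b, ∏ i, (1 + x i * if b = a then 1 else 0) := by
  set Q := ∏ i ∈ Finset.univ.erase j, (1 + x i) with hQ
  have hq : ∀ b, ∏ i ∈ Finset.univ.erase j, (1 + x i * if b = a then 1 else 0) =
      1 + (Q - 1) * if b = a then 1 else 0 := by
    intro b; by_cases hb : b = a <;> simp [hb, hQ]
  have e : ∀ b, ∏ i, (1 + x i * if b = Function.update (fun _ => a) j c i then 1 else 0) =
      1 + x j * (if b = c then 1 else 0) + (Q - 1) * if b = a then 1 else 0 := by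
    intro b
    rw [← Finset.mul_prod_erase _ _ (Finset.mem_univ j)]
    have : ∏ i ∈ Finset.univ.erase j,
        (1 + x i * if b = Function.update (fun _ => a) j c i then 1 else 0) =
        1 + (Q - 1) * if b = a then 1 else 0 := by
      rw [← hq]
      refine Finset.prod_congr rfl fun i hi => ?_
      rw [Function.update_of_ne (Finset.ne_of_mem_erase hi)]
    rw [this, Function.update_self]
    by_cases hb : b = a
    · subst hb; simp [hac.symm]
    · simp [hb]
  have e' : ∀ b, ∏ i, (1 + x i * if b = a then 1 else 0) =
      1 + (x j + (Q - 1) + x j * (Q - 1)) * if b = a then 1 else 0 := by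
    intro b
    rw [← Finset.mul_prod_erase _ _ (Finset.mem_univ j), hq]
    by_cases hb : b = a
    · simp [hb]; ring
    · simp [hb]
  simp only [e, e', Finset.sum_add_distrib, ← Finset.mul_sum, Finset.sum_ite_eq',
    Finset.mem_univ, if_true]
  linarith

/-! ### Growth of the path coefficients and signs of deviations -/

/-- The number of proper `m`-colorings of a path with `n` edges whose ends have two prescribed
distinct colors. -/
def pathCoeff (m : ℕ) : ℕ → ℚ
  | 0 => 0
  | n + 1 => (m - 1) * pathCoeff m n + (-1) ^ n

theorem one_le_pathCoeff {m : ℕ} (hm : 3 ≤ m) (n : ℕ) : 1 ≤ pathCoeff m (n + 1) := by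
  have hm' : (3 : ℚ) ≤ m := by exact_mod_cast hm
  induction n with
  | zero => simp [pathCoeff]
  | succ n ih =>
    rw [pathCoeff]
    rcases neg_one_pow_eq_or ℚ (n + 1) with h | h <;> rw [h] <;> nlinarith

/-- The term `±1` in the recursion is absorbed by one copy of `pathCoeff m (n + 1) ≥ 1`. -/
theorem mul_pathCoeff_le_succ {m : ℕ} (hm : 3 ≤ m) (n : ℕ) :
    (m - 2) * pathCoeff m (n + 1) ≤ pathCoeff m (n + 2) := by
  have h1 := one_le_pathCoeff hm n
  rw [pathCoeff.eq_2 m (n + 1)]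
  rcases neg_one_pow_eq_or ℚ (n + 1) with h | h <;> rw [h] <;> nlinarith

theorem mul_pathCoeff_le {m : ℕ} (hm : 3 ≤ m) {n n' : ℕ} (hn : 1 ≤ n) (h : n < n') :
    (m - 2) * pathCoeff m n ≤ pathCoeff m n' := by
  have hm' : (3 : ℚ) ≤ m := by exact_mod_cast hm
  induction n', h using Nat.le_induction with
  | base =>
    obtain ⟨n, rfl⟩ := Nat.exists_eq_add_of_le' hn
    exact mul_pathCoeff_le_succ hm n
  | succ n' h ih =>
    obtain ⟨p, rfl⟩ := Nat.exists_eq_add_of_le' (hn.trans (Nat.le_of_succ_le h))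
    have h1 := mul_pathCoeff_le_succ hm p
    have h2 := one_le_pathCoeff hm p
    nlinarith

/-- The relative deviation of the number of colorings of a path with `n` edges when its ends
receive corresponding instead of non-corresponding colors. -/
def pathDeviation (m n : ℕ) : ℚ := (-1) ^ n / pathCoeff m n

theorem abs_pathDeviation_le_one {m : ℕ} (hm : 3 ≤ m) {n : ℕ} (hn : 1 ≤ n) :
    |pathDeviation m n| ≤ 1 := by
  obtain ⟨p, rfl⟩ := Nat.exists_eq_add_of_le' hn
  have h := one_le_pathCoeff hm p
  rw [pathDeviation, abs_div, abs_pow, abs_neg, abs_one, one_pow, abs_of_pos (by linarith)]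
  exact (div_le_one (by linarith)).2 h

theorem neg_one_pow_mul_pathDeviation (m : ℕ) (n n' : ℕ) :
    (-1) ^ n * pathDeviation m n' =
      if Even n ↔ Even n' then 1 / pathCoeff m n' else -(1 / pathCoeff m n') := by
  rw [pathDeviation]
  rcases Nat.even_or_odd n with h | h <;> rcases Nat.even_or_odd n' with h' | h' <;>
    simp [h, h', h.neg_one_pow, h'.neg_one_pow, ← Nat.not_odd_iff_even] <;> ring

/-- For large `m`, a product of `1 +` deviations of paths including a shortest one differs from `1`
in the same direction as the shortest one, if all paths of equal length count for that one. -/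
theorem sign_prod_pathDeviation {k : ℕ} (l : Fin k → ℕ) (hpos : ∀ i, 1 ≤ l i) (i₀ : Fin k)
    (hmin : ∀ i, l i₀ ≤ l i) {m : ℕ} (hm : 2 * k + 3 ≤ m) (s : Finset (Fin k)) (hs : i₀ ∈ s) :
    0 < (-1) ^ l i₀ * (∏ i ∈ s, (1 + pathDeviation m (l i)) - 1) := by
  have hm3 : 3 ≤ m := by omega
  have hmq : (2 * k + 3 : ℚ) ≤ m := by exact_mod_cast hm
  have hc : ∀ i, 1 ≤ pathCoeff m (l i) := fun i => by
    obtain ⟨p, hp⟩ := Nat.exists_eq_add_of_le' (hpos i)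
    rw [hp]; exact one_le_pathCoeff hm3 p
  have hc0 := hc i₀
  have hsk : (s.card : ℚ) ≤ k := by
    exact_mod_cast (Finset.card_le_univ s).trans (by simp)
  have hpc : 0 < (2 * k + 1) * pathCoeff m (l i₀) := by positivity
  -- At most `k` factors deviate the wrong way, each by at most `1 / (2k + 1)` of the main
  -- deviation; doubled, this still falls short of it.
  refine sign_mul_prod_one_add_sub_one_pos (fun i => pathDeviation m (l i)) _
    (1 / ((2 * k + 1) * pathCoeff m (l i₀))) (neg_one_pow_eq_or ℚ _) s i₀ hs (by positivity)
    ?_ (fun i => abs_pathDeviation_le_one hm3 (hpos i)) ?_ ?_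
  · rw [neg_one_pow_mul_pathDeviation, if_pos Iff.rfl]; positivity
  · rw [neg_one_pow_mul_pathDeviation, if_pos Iff.rfl, mul_one_div, mul_div_assoc',
      div_lt_div_iff₀ hpc (by linarith)]
    nlinarith
  · intro i
    have hci := hc i
    have h0 : 0 < 1 / ((2 * k + 1) * pathCoeff m (l i₀)) := by positivity
    have h1 : 0 < 1 / pathCoeff m (l i) := by positivity
    rw [neg_one_pow_mul_pathDeviation]
    split_ifs with h
    · linarith
    · refine neg_le_neg (one_div_le_one_div_of_le hpc ?_)
      -- Opposite parity makes the path strictly longer, which gains the factor `m - 2 ≥ 2k + 1`.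
      have hlt : l i₀ < l i := lt_of_le_of_ne (hmin i) fun he => h (by rw [he])
      refine le_trans ?_ (mul_pathCoeff_le hm3 (hpos i₀) hlt)
      nlinarith

/-! ### Twisted colorings of a path -/

/-- The sequence of values along a path with ends `a`, `b` and `n` internal values `g`. -/
def pathSeq {α : Type*} {n : ℕ} (a b : α) (g : Fin n → α) (j : ℕ) : α :=
  if j = 0 then a else if h : j - 1 < n then g ⟨j - 1, h⟩ else b

/-- Internal values along a path turning it into a coloring twisted by the permutations `θ j`. -/
abbrev TwistedPath {α : Type*} (θ : ℕ → Equiv.Perm α) (n : ℕ) (a b : α) : Type _ :=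
  {g : Fin n → α // ∀ j < n + 1, pathSeq a b g (j + 1) ≠ θ j (pathSeq a b g j)}

/-- The permutation obtained by following the first `n` edges of a path. -/
def pathPerm {α : Type*} (θ : ℕ → Equiv.Perm α) : ℕ → Equiv.Perm α
  | 0 => 1
  | n + 1 => θ n * pathPerm θ n

theorem pathSeq_snoc_of_le {α : Type*} {n : ℕ} (a b c : α) (g : Fin n → α) {j : ℕ}
    (hj : j ≤ n + 1) :
    pathSeq a b (Fin.snoc g c : Fin (n + 1) → α) j = pathSeq a c g j := by
  unfold pathSeq
  by_cases h0 : j = 0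
  · simp [h0]
  · have h1 : j - 1 < n + 1 := by omega
    by_cases h2 : j - 1 < n
    · simp [h0, h1, h2, Fin.snoc]
    · simp [h0, h1, h2, Fin.snoc]

theorem pathSeq_last {α : Type*} {n : ℕ} (a b : α) (g : Fin n → α) :
    pathSeq a b g (n + 1) = b := by
  simp [pathSeq]

theorem forall_pathSeq_snoc_iff {α : Type*} (θ : ℕ → Equiv.Perm α) {n : ℕ} (a b c : α)
    (g : Fin n → α) :
    (∀ j < n + 1 + 1, pathSeq a b (Fin.snoc g c : Fin (n + 1) → α) (j + 1) ≠
        θ j (pathSeq a b (Fin.snoc g c : Fin (n + 1) → α) j)) ↔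
      b ≠ θ (n + 1) c ∧ ∀ j < n + 1, pathSeq a c g (j + 1) ≠ θ j (pathSeq a c g j) := by
  rw [Nat.forall_lt_succ_right, and_comm]
  refine and_congr ?_ (forall₂_congr fun j hj => ?_)
  · rw [pathSeq_last, pathSeq_snoc_of_le _ _ _ _ le_rfl, pathSeq_last]
  · rw [pathSeq_snoc_of_le _ _ _ _ hj, pathSeq_snoc_of_le _ _ _ _ hj.le]

/-- Splitting off the last internal value of a twisted path. -/
def twistedPathSuccEquiv {α : Type*} (θ : ℕ → Equiv.Perm α) (n : ℕ) (a b : α) :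
    TwistedPath θ (n + 1) a b ≃ Σ c : {c // b ≠ θ (n + 1) c}, TwistedPath θ n a c.1 where
  toFun g :=
    have h := (forall_pathSeq_snoc_iff θ a b (g.1 (Fin.last n)) (Fin.init g.1)).1
      (by rw [Fin.snoc_init_self]; exact g.2)
    ⟨⟨g.1 (Fin.last n), h.1⟩, ⟨Fin.init g.1, h.2⟩⟩
  invFun p := ⟨Fin.snoc p.2.1 p.1.1, (forall_pathSeq_snoc_iff θ a b _ _).2 ⟨p.1.2, p.2.2⟩⟩
  left_inv g := Subtype.ext (Fin.snoc_init_self g.1)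
  right_inv := by
    rintro ⟨⟨c, hc⟩, ⟨g, hg⟩⟩
    have h1 : (Fin.snoc g c : Fin (n + 1) → α) (Fin.last n) = c := Fin.snoc_last _ _
    have h2 : Fin.init (Fin.snoc g c : Fin (n + 1) → α) = g := Fin.init_snoc _ _
    apply Sigma.subtype_ext
    · exact Subtype.ext h1
    · exact h2

/-- Induction on the last internal value `c`: it may be anything but the preimage of `b`, so the sum
over all `c` is corrected by a single term. -/
theorem card_twistedPath {m : ℕ} (θ : ℕ → Equiv.Perm (Fin m)) (n : ℕ) (a b : Fin m) :
    (Nat.card (TwistedPath θ n a b) : ℚ) =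
      pathCoeff m (n + 1) + (-1) ^ (n + 1) * if b = pathPerm θ (n + 1) a then 1 else 0 := by
  induction n generalizing b with
  | zero =>
    by_cases h : b = θ 0 a
    · have : IsEmpty (TwistedPath θ 0 a b) :=
        ⟨fun g => g.2 0 zero_lt_one (by simpa [pathSeq] using h)⟩
      rw [Nat.card_of_isEmpty]
      simp [h, pathCoeff, pathPerm]
    · have : Unique (TwistedPath θ 0 a b) :=
        { default := ⟨Fin.elim0, fun j hj => by
            obtain rfl : j = 0 := by omega
            simpa [pathSeq] using h⟩
          uniq := fun g => Subtype.ext (Subsingleton.elim _ _) }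
      rw [Nat.card_unique]
      simp [h, pathCoeff, pathPerm]
  | succ n ih =>
    rw [Nat.card_congr (twistedPathSuccEquiv θ n a b), Nat.card_sigma]
    push_cast
    simp only [ih]
    have hs : ∀ f : Fin m → ℚ, ∑ c : {c // b ≠ θ (n + 1) c}, f c =
        ∑ c, f c - f ((θ (n + 1)).symm b) := by
      intro f
      rw [eq_sub_iff_add_eq, ← Finset.sum_erase_add _ _ (Finset.mem_univ ((θ (n + 1)).symm b))]
      congr 1
      refine (Finset.sum_subtype _ (fun c => ?_) f).symm
      simp [Equiv.eq_symm_apply, eq_comm]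
    rw [hs fun c => pathCoeff m (n + 1) +
      (-1) ^ (n + 1) * if c = pathPerm θ (n + 1) a then 1 else 0]
    simp only [Finset.sum_add_distrib, ← Finset.mul_sum, Finset.sum_ite_eq', Finset.mem_univ,
      if_true, Finset.sum_const, Finset.card_univ, Fintype.card_fin, nsmul_eq_mul]
    rw [pathCoeff.eq_2 m (n + 1), pathPerm.eq_2 θ (n + 1), Equiv.Perm.mul_apply]
    simp only [Equiv.symm_apply_eq]
    ring

/-! ### Twisted colorings of Theta graphs -/

/-- Colorings of a generalized Theta graph twisted by a permutation on each edge of the paths. -/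
abbrev TwistedThetaColoring {k : ℕ} (l : Fin k → ℕ) {α : Type*} (θ : Fin k → ℕ → Equiv.Perm α) :
    Type _ :=
  {f : ThetaVertex l → α // ∀ i, ∀ j < l i,
    f (thetaPathVertex l i (j + 1)) ≠ θ i j (f (thetaPathVertex l i j))}

theorem apply_thetaPathVertex {k : ℕ} (l : Fin k → ℕ) {α : Type*} (f : ThetaVertex l → α)
    (i : Fin k) (j : ℕ) :
    f (thetaPathVertex l i j) =
      pathSeq (f (Sum.inl false)) (f (Sum.inl true)) (fun t => f (Sum.inr ⟨i, t⟩)) j := by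
  unfold thetaPathVertex pathSeq
  split_ifs <;> rfl

/-- A twisted coloring consists of the colors of the end vertices and the colors along the paths. -/
def twistedThetaColoringEquiv {k : ℕ} (l : Fin k → ℕ) (hpos : ∀ i, 1 ≤ l i) {α : Type*}
    (θ : Fin k → ℕ → Equiv.Perm α) :
    TwistedThetaColoring l θ ≃ Σ ab : α × α, ∀ i, TwistedPath (θ i) (l i - 1) ab.1 ab.2 where
  toFun f := ⟨(f.1 (Sum.inl false), f.1 (Sum.inl true)), fun i =>
    ⟨fun t => f.1 (Sum.inr ⟨i, t⟩), fun j hj => by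
      have := f.2 i j (by have := hpos i; omega)
      rwa [apply_thetaPathVertex l f.1, apply_thetaPathVertex l f.1] at this⟩⟩
  invFun p := ⟨Sum.elim (fun b => if b then p.1.2 else p.1.1) fun v => (p.2 v.1).1 v.2,
    fun i j hj => by
      rw [apply_thetaPathVertex l (Sum.elim _ _), apply_thetaPathVertex l (Sum.elim _ _)]
      exact (p.2 i).2 j (by omega)⟩
  left_inv f := by
    refine Subtype.ext (funext fun v => ?_)
    rcases v with (_ | _) | v <;> rfl
  right_inv p := rfl

theorem card_twistedThetaColoring {k : ℕ} (l : Fin k → ℕ) (hpos : ∀ i, 1 ≤ l i) {m : ℕ}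
    (hm : 3 ≤ m) (θ : Fin k → ℕ → Equiv.Perm (Fin m)) :
    (Nat.card (TwistedThetaColoring l θ) : ℚ) = (∏ i, pathCoeff m (l i)) * ∑ a, ∑ b,
      ∏ i, (1 + pathDeviation m (l i) * if b = pathPerm (θ i) (l i) a then 1 else 0) := by
  rw [Nat.card_congr (twistedThetaColoringEquiv l hpos θ), Nat.card_sigma, Fintype.sum_prod_type]
  simp only [Nat.card_pi]
  push_cast
  simp only [Finset.mul_sum, ← Finset.prod_mul_distrib]
  refine Finset.sum_congr rfl fun a _ => Finset.sum_congr rfl fun b _ =>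
    Finset.prod_congr rfl fun i _ => ?_
  obtain ⟨p, hp⟩ := Nat.exists_eq_add_of_le' (hpos i)
  have h1 := one_le_pathCoeff hm p
  rw [card_twistedPath, hp, pathDeviation]
  simp only [Nat.add_sub_cancel]
  field_simp

/-! ### Covers versus twisted colorings -/

/-- Lists are cliques, so an independent set meets each list at most once; having size `|V|`, it
meets each exactly once and is the graph of a function. -/
theorem DPCover.numColorings_le_card_of_prod {V : Type} [Fintype V] {G : SimpleGraph V} {m : ℕ}
    (C : DPCover G (V × Fin m)) (hL : ∀ v x, x ∈ C.L v ↔ x.1 = v) :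
    C.numColorings ≤ Nat.card {f : V → Fin m // ∀ u v, ¬ C.H.Adj (u, f u) (v, f v)} := by
  classical
  have hinj : ∀ I : {I : Finset (V × Fin m) // C.IsColoring I},
      Set.InjOn Prod.fst (I.1 : Set (V × Fin m)) := by
    intro I x hx y hy hxy
    by_contra hne
    exact I.2.1 hx hy hne (C.isClique_L x.1 ((hL _ _).2 rfl) ((hL _ _).2 hxy.symm) hne)
  have hex : ∀ I : {I : Finset (V × Fin m) // C.IsColoring I}, ∀ v, ∃ c, (v, c) ∈ I.1 := by
    intro I v
    have : I.1.image Prod.fst = Finset.univ := by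
      rw [← Finset.card_eq_iff_eq_univ, Finset.card_image_of_injOn (hinj I), I.2.2]
    obtain ⟨x, hx, rfl⟩ := Finset.mem_image.1 (this ▸ Finset.mem_univ v)
    exact ⟨x.2, hx⟩
  choose F hF using hex
  refine Nat.card_le_card_of_injective (fun I => ⟨F I, fun u v h => ?_⟩) fun I J hIJ => ?_
  · exact I.2.1 (hF I u) (hF I v) (fun e => h.ne e) h
  · have hFIJ : F I = F J := congrArg Subtype.val hIJ
    have hmem : ∀ I x, x ∈ I.1 ↔ F I x.1 = x.2 := by
      intro I x
      refine ⟨fun hx => congrArg Prod.snd (hinj I (hF I x.1) hx rfl), fun h => ?_⟩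
      have := hF I x.1
      rwa [h] at this
    refine Subtype.ext (Finset.ext fun x => ?_)
    rw [hmem, hmem, hFIJ]

/-- The cover of `G` whose matchings are given by the permutations `φ u v`. -/
def DPCover.ofPerm {V : Type*} [Fintype V] [DecidableEq V] (G : SimpleGraph V) {m : ℕ}
    (φ : V → V → Equiv.Perm (Fin m)) (hφ : ∀ u v, φ v u = (φ u v)⁻¹) :
    DPCover G (V × Fin m) where
  H :=
    { Adj := fun x y => x ≠ y ∧ (x.1 = y.1 ∨ (G.Adj x.1 y.1 ∧ y.2 = φ x.1 y.1 x.2))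
      symm := ⟨fun x y h => by
        refine ⟨h.1.symm, h.2.imp Eq.symm fun h => ⟨h.1.symm, ?_⟩⟩
        simp [hφ x.1 y.1, h.2]⟩
      loopless := ⟨fun x h => h.1 rfl⟩ }
  L v := Finset.univ.filter fun x => x.1 = v
  disjoint_L u v huv := by
    rw [Finset.disjoint_left]
    intro x hx hy
    simp only [Finset.mem_filter, Finset.mem_univ, true_and] at hx hy
    exact huv (hx.symm.trans hy)
  exists_mem_L x := ⟨x.1, by simp⟩
  isClique_L v x hx y hy hxy := by
    simp only [Finset.coe_filter, Finset.mem_univ, true_and, Set.mem_ofPred_eq] at hx hy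
    exact ⟨hxy, Or.inl (hx.trans hy.symm)⟩
  eq_or_adj u v x hx y hy h := by
    simp only [Finset.mem_filter, Finset.mem_univ, true_and] at hx hy
    subst hx hy
    exact h.2.imp id And.left
  matching u v huv x hx y hy y' hy' h h' := by
    simp only [Finset.mem_filter, Finset.mem_univ, true_and] at hx hy hy'
    subst hx hy
    have e := h.2.resolve_left huv.ne
    have e' := h'.2.resolve_left (fun he => huv.ne (he.trans hy'))
    refine Prod.ext hy'.symm ?_
    rw [e.2, e'.2, hy']

theorem dpColorFunction_le_card {V : Type} [Fintype V] (G : SimpleGraph V) {m : ℕ}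
    (φ : V → V → Equiv.Perm (Fin m)) (hφ : ∀ u v, φ v u = (φ u v)⁻¹) :
    dpColorFunction G m ≤
      Nat.card {f : V → Fin m // ∀ u v, G.Adj u v → f v ≠ φ u v (f u)} := by
  classical
  have hL : ∀ v x, x ∈ (DPCover.ofPerm G φ hφ).L v ↔ x.1 = v := fun v x => by
    simp [DPCover.ofPerm]
  have hfold : (DPCover.ofPerm G φ hφ).IsFold m := by
    intro v
    have : (DPCover.ofPerm G φ hφ).L v = {v} ×ˢ Finset.univ := by
      ext x
      rw [hL, Finset.mem_product]
      simp
    rw [this, Finset.card_product]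
    simp
  have hle : dpColorFunction G m ≤ (DPCover.ofPerm G φ hφ).numColorings :=
    Nat.sInf_le ⟨_, DPCover.ofPerm G φ hφ, hfold, rfl⟩
  refine hle.trans ((DPCover.numColorings_le_card_of_prod _ hL).trans ?_)
  refine Nat.card_le_card_of_injective
    (fun f => ⟨f.1, fun u v huv he => f.2 u v ⟨?_, Or.inr ⟨huv, he⟩⟩⟩) fun f g h => ?_
  · exact fun e => huv.ne (congrArg Prod.fst e)
  · exact Subtype.ext (Subtype.mk.inj h)

/-- A partial injection of a finite set is a bijection between two subsets, whose complements are
equinumerous. -/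
theorem exists_perm_extending {α : Type*} [Finite α] (R : α → α → Prop)
    (h₁ : ∀ x y y', R x y → R x y' → y = y') (h₂ : ∀ x x' y, R x y → R x' y → x = x') :
    ∃ σ : Equiv.Perm α, ∀ x y, R x y → σ x = y := by
  classical
  have := Fintype.ofFinite α
  let e : {x // ∃ y, R x y} ≃ {y // ∃ x, R x y} :=
    { toFun := fun x => ⟨x.2.choose, x.1, x.2.choose_spec⟩
      invFun := fun y => ⟨y.2.choose, y.1, y.2.choose_spec⟩
      left_inv := fun x => Subtype.ext
        (h₂ _ _ _ (Exists.choose_spec (p := fun z => R z x.2.choose) _) x.2.choose_spec)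
      right_inv := fun y => Subtype.ext
        (h₁ _ _ _ (Exists.choose_spec (p := fun z => R y.2.choose z) _) y.2.choose_spec) }
  refine ⟨e.extendSubtype, fun x y hxy => ?_⟩
  rw [Equiv.extendSubtype_apply_of_mem e x ⟨y, hxy⟩]
  exact h₁ _ _ _ (Exists.choose_spec (p := fun z => R x z) _) hxy

theorem thetaPathVertex_succ_ne_inl_false {k : ℕ} (l : Fin k → ℕ) (i : Fin k) (j : ℕ) :
    thetaPathVertex l i (j + 1) ≠ Sum.inl false := by
  rw [thetaPathVertex, if_neg (Nat.succ_ne_zero j)]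
  split_ifs <;> simp

theorem thetaPathVertex_adj {k : ℕ} (l : Fin k → ℕ) {i : Fin k} {j : ℕ} (hj : j < l i) :
    (generalizedTheta l).Adj (thetaPathVertex l i j) (thetaPathVertex l i (j + 1)) := by
  refine (SimpleGraph.fromRel_adj _ _ _).2 ⟨?_, Or.inl ⟨i, j, hj, rfl, rfl⟩⟩
  rcases Nat.eq_zero_or_pos j with rfl | h
  · exact (thetaPathVertex_succ_ne_inl_false l i 0).symm
  · have h1 : j - 1 < l i - 1 := by omega
    unfold thetaPathVertex
    rw [if_neg h.ne', dif_pos h1, if_neg (Nat.succ_ne_zero j)]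
    split_ifs
    · simp; omega
    · simp

theorem exists_card_twistedThetaColoring_le_numColorings {k : ℕ} (l : Fin k → ℕ) {m : ℕ}
    {W : Type*} (C : DPCover (generalizedTheta l) W) (hC : C.IsFold m) :
    ∃ θ : Fin k → ℕ → Equiv.Perm (Fin m),
      Nat.card (TwistedThetaColoring l θ) ≤ C.numColorings := by
  classical
  -- Finiteness matters: `Nat.card` of an infinite type would be 0.
  have : Finite W := by
    refine Set.finite_univ_iff.1
      ((Finset.univ.biUnion C.L).finite_toSet.subset fun x _ => ?_)
    obtain ⟨v, hv⟩ := C.exists_mem_L x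
    exact Finset.mem_coe.2 (Finset.mem_biUnion.2 ⟨v, Finset.mem_univ v, hv⟩)
  let e : ∀ v, Fin m ≃ C.L v := fun v => ((C.L v).equivFinOfCardEq (hC v)).symm
  have hθ : ∀ i j, ∃ σ : Equiv.Perm (Fin m), j < l i → ∀ x y,
      C.H.Adj (e (thetaPathVertex l i j) x).1 (e (thetaPathVertex l i (j + 1)) y).1 →
        σ x = y := by
    intro i j
    by_cases hj : j < l i
    · obtain ⟨σ, hσ⟩ := exists_perm_extending (fun x y => C.H.Adj
        (e (thetaPathVertex l i j) x).1 (e (thetaPathVertex l i (j + 1)) y).1)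
        (fun x y y' h h' => (e _).injective (Subtype.ext
          (C.matching _ _ (thetaPathVertex_adj l hj) _ (e _ _).2 _ (e _ _).2 _ (e _ _).2 h h')))
        (fun x x' y h h' => (e _).injective (Subtype.ext
          (C.matching _ _ (thetaPathVertex_adj l hj).symm _ (e _ _).2 _ (e _ _).2 _ (e _ _).2
            h.symm h'.symm)))
      exact ⟨σ, fun _ => hσ⟩
    -- Indices beyond the end of the path impose no condition on twisted colorings.
    · exact ⟨1, fun h => absurd h hj⟩
  choose θ hθ using hθ
  have heq : ∀ (f g : ThetaVertex l → Fin m) u v, (e u (f u)).1 = (e v (g v)).1 → u = v := by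
    intro f g u v h
    by_contra hne
    exact Finset.disjoint_left.1 (C.disjoint_L u v hne) (e u (f u)).2 (h ▸ (e v (g v)).2)
  refine ⟨θ, Nat.card_le_card_of_injective
    (fun f => ⟨Finset.univ.image fun v => (e v (f.1 v)).1, ?_, ?_⟩) fun f g h => ?_⟩
  · intro x hx y hy hxy hadj
    simp only [Finset.coe_image, Finset.coe_univ, Set.image_univ, Set.mem_range] at hx hy
    obtain ⟨u, rfl⟩ := hx
    obtain ⟨v, rfl⟩ := hy
    rcases C.eq_or_adj u v _ (e u _).2 _ (e v _).2 hadj with rfl | huv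
    · exact hxy rfl
    · obtain ⟨-, ⟨i, j, hj, rfl, rfl⟩ | ⟨i, j, hj, rfl, rfl⟩⟩ :=
        (SimpleGraph.fromRel_adj _ _ _).1 huv
      · exact f.2 i j hj (hθ i j hj _ _ hadj).symm
      · exact f.2 i j hj (hθ i j hj _ _ hadj.symm).symm
  · rw [Finset.card_image_of_injective _ fun u v h => heq f.1 f.1 u v h, Finset.card_univ]
  · refine Subtype.ext (funext fun v => ?_)
    have h' : (Finset.univ.image fun v => (e v (f.1 v)).1) =
      Finset.univ.image fun v => (e v (g.1 v)).1 := congrArg Subtype.val h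
    obtain ⟨u, -, hu⟩ := Finset.mem_image.1
      (h' ▸ Finset.mem_image_of_mem (fun v => (e v (f.1 v)).1) (Finset.mem_univ v))
    obtain rfl := heq g.1 f.1 u v hu
    exact ((e u).injective (Subtype.ext hu)).symm

theorem dpColorFunction_generalizedTheta_le {k : ℕ} (l : Fin k → ℕ) {m : ℕ}
    (φ : ThetaVertex l → ThetaVertex l → Equiv.Perm (Fin m)) (hφ : ∀ u v, φ v u = (φ u v)⁻¹) :
    dpColorFunction (generalizedTheta l) m ≤ Nat.card (TwistedThetaColoring l fun i j =>
      φ (thetaPathVertex l i j) (thetaPathVertex l i (j + 1))) := by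
  refine (dpColorFunction_le_card _ φ hφ).trans (Nat.card_le_card_of_injective
    (fun f => ⟨f.1, fun i j hj => f.2 _ _ (thetaPathVertex_adj l hj)⟩) fun f g h => ?_)
  exact Subtype.ext (Subtype.mk.inj h)

theorem chromaticCount_generalizedTheta {k : ℕ} (l : Fin k → ℕ) (m : ℕ) :
    chromaticCount (generalizedTheta l) m =
      Nat.card (TwistedThetaColoring l fun _ _ => (1 : Equiv.Perm (Fin m))) := by
  refine Nat.card_congr
    { toFun := fun f => ⟨f, fun i j hj => (f.valid (thetaPathVertex_adj l hj)).symm⟩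
      invFun := fun f => SimpleGraph.Coloring.mk f.1 fun {u v} huv => ?_
      left_inv := fun f => by ext; rfl
      right_inv := fun f => rfl }
  obtain ⟨-, ⟨i, j, hj, rfl, rfl⟩ | ⟨i, j, hj, rfl, rfl⟩⟩ := (SimpleGraph.fromRel_adj _ _ _).1 huv
  · exact (f.2 i j hj).symm
  · exact f.2 i j hj

/-! ### Invariance under isomorphism -/

/-- Transport of a cover along an isomorphism. -/
def DPCover.comapIso {V V' W : Type*} {G : SimpleGraph V} {G' : SimpleGraph V'}
    (C : DPCover G' W) (e : G ≃g G') : DPCover G W where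
  H := C.H
  L v := C.L (e v)
  disjoint_L u v huv := C.disjoint_L _ _ (e.injective.ne huv)
  exists_mem_L x := by
    obtain ⟨v, hv⟩ := C.exists_mem_L x
    exact ⟨e.symm v, by simpa using hv⟩
  isClique_L v := C.isClique_L (e v)
  eq_or_adj u v x hx y hy h :=
    (C.eq_or_adj _ _ x hx y hy h).imp (fun h => e.injective h) e.map_adj_iff.1
  matching u v huv := C.matching _ _ (e.map_adj_iff.2 huv)

theorem dpColorFunction_le_of_iso {V V' : Type*} [Fintype V] [Fintype V'] {G : SimpleGraph V}
    {G' : SimpleGraph V'} (e : G ≃g G') (m : ℕ) :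
    dpColorFunction G m ≤ dpColorFunction G' m := by
  obtain ⟨W, C, hC, hn⟩ := Nat.sInf_mem
    (s := {n : ℕ | ∃ (W : Type) (C : DPCover G' W), C.IsFold m ∧ C.numColorings = n})
    (by obtain ⟨W, C, hC⟩ := exists_isFold G' m; exact ⟨_, W, C, hC, rfl⟩)
  refine Nat.sInf_le ⟨W, C.comapIso e, fun v => hC (e v), Eq.trans ?_ hn⟩
  simp only [DPCover.numColorings, DPCover.IsColoring, Fintype.card_congr e.toEquiv]
  rfl

theorem dpColorFunction_congr {V V' : Type*} [Fintype V] [Fintype V'] {G : SimpleGraph V}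
    {G' : SimpleGraph V'} (e : G ≃g G') (m : ℕ) : dpColorFunction G m = dpColorFunction G' m :=
  (dpColorFunction_le_of_iso e m).antisymm (dpColorFunction_le_of_iso e.symm m)

theorem chromaticCount_congr {V V' : Type*} {G : SimpleGraph V} {G' : SimpleGraph V'}
    (e : G ≃g G') (m : ℕ) : chromaticCount G m = chromaticCount G' m :=
  Nat.card_congr
    { toFun := fun f => f.comp e.symm.toHom
      invFun := fun f => f.comp e.toHom
      left_inv := fun f => by ext v; simp
      right_inv := fun f => by ext v; simp }

/-! ### The two parity cases -/

theorem pathPerm_one {α : Type*} (n : ℕ) : pathPerm (fun _ => (1 : Equiv.Perm α)) n = 1 := by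
  induction n with
  | zero => rfl
  | succ n ih => rw [pathPerm, ih, one_mul]

theorem dpColorFunction_generalizedTheta_eq {k : ℕ} (l : Fin k → ℕ) (hpos : ∀ i, 1 ≤ l i)
    (i₀ : Fin k) (hmin : ∀ i, l i₀ ≤ l i) (hpar : ∀ j, j ≠ i₀ → ¬ (Even (l i₀) ↔ Even (l j)))
    {m : ℕ} (hm : 2 * k + 3 ≤ m) :
    dpColorFunction (generalizedTheta l) m = chromaticCount (generalizedTheta l) m := by
  have hm3 : 3 ≤ m := by omega
  have hc : ∀ i, 0 < pathCoeff m (l i) := fun i => by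
    obtain ⟨p, hp⟩ := Nat.exists_eq_add_of_le' (hpos i)
    rw [hp]; exact lt_of_lt_of_le one_pos (one_le_pathCoeff hm3 p)
  rw [chromaticCount_generalizedTheta]
  refine le_antisymm (dpColorFunction_generalizedTheta_le l (fun _ _ => 1) (by simp)) ?_
  obtain ⟨W, C, hC, hn⟩ := Nat.sInf_mem (s := {n : ℕ | ∃ (W : Type)
      (C : DPCover (generalizedTheta l) W), C.IsFold m ∧ C.numColorings = n})
    (by obtain ⟨W, C, hC⟩ := exists_isFold (generalizedTheta l) m; exact ⟨_, W, C, hC, rfl⟩)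
  obtain ⟨θ, hθ⟩ := exists_card_twistedThetaColoring_le_numColorings l C hC
  refine le_trans ?_ (hθ.trans_eq hn)
  rw [← Nat.cast_le (α := ℚ), card_twistedThetaColoring l hpos hm3,
    card_twistedThetaColoring l hpos hm3]
  -- The comparison already holds for each color `a` of the first end vertex.
  refine mul_le_mul_of_nonneg_left (Finset.sum_le_sum fun a _ => ?_)
    (Finset.prod_nonneg fun i _ => (hc i).le)
  simp only [pathPerm_one, Equiv.Perm.one_apply]
  refine sum_prod_ite_const_le (fun i => pathDeviation m (l i)) ((-1) ^ l i₀)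
    (neg_one_pow_eq_or ℚ _) i₀ (fun s hs => sign_prod_pathDeviation l hpos i₀ hmin hm s hs)
    (fun i => abs_pathDeviation_le_one hm3 (hpos i)) (fun i hi => ?_) _ a
  rw [neg_one_pow_mul_pathDeviation, if_neg (hpar i hi)]
  have := one_div_pos.2 (hc i)
  linarith

/-- Permutations on the pairs of vertices of a Theta graph that twist the edge between the
first end vertex and its neighbor `w` by `τ`. -/
def thetaTwist {k : ℕ} (l : Fin k → ℕ) {α : Type*} (w : ThetaVertex l) (τ : Equiv.Perm α)
    (u v : ThetaVertex l) : Equiv.Perm α :=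
  if u = Sum.inl false ∧ v = w then τ else if v = Sum.inl false ∧ u = w then τ⁻¹ else 1

theorem thetaTwist_symm {k : ℕ} (l : Fin k → ℕ) {α : Type*} {w : ThetaVertex l}
    (hw : w ≠ Sum.inl false) (τ : Equiv.Perm α) (u v : ThetaVertex l) :
    thetaTwist l w τ v u = (thetaTwist l w τ u v)⁻¹ := by
  unfold thetaTwist
  split_ifs <;> simp_all

/-- Only the first edge of a path meets the first end vertex, and it leads to the chosen internal
vertex only on path `i₁`. -/
theorem pathPerm_thetaTwist {k : ℕ} (l : Fin k → ℕ) {α : Type*} (τ : Equiv.Perm α)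
    (i₁ : Fin k) (h : 0 < l i₁ - 1) (i : Fin k) {n : ℕ} (hn : 1 ≤ n) :
    pathPerm (fun j => thetaTwist l (Sum.inr ⟨i₁, ⟨0, h⟩⟩) τ (thetaPathVertex l i j)
      (thetaPathVertex l i (j + 1))) n = if i = i₁ then τ else 1 := by
  have hz : thetaPathVertex l i 0 = Sum.inl false := rfl
  have h1 : thetaPathVertex l i 1 = Sum.inr ⟨i₁, ⟨0, h⟩⟩ ↔ i = i₁ := by
    unfold thetaPathVertex
    constructor
    · intro he
      split_ifs at he <;> simp_all
    · rintro rfl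
      simp [h]
  have hs : ∀ j, 1 ≤ j → thetaTwist l (Sum.inr ⟨i₁, ⟨0, h⟩⟩) τ (thetaPathVertex l i j)
      (thetaPathVertex l i (j + 1)) = 1 := by
    intro j hj
    obtain ⟨p, rfl⟩ := Nat.exists_eq_add_of_le' hj
    simp [thetaTwist, thetaPathVertex_succ_ne_inl_false]
  induction n, hn using Nat.le_induction with
  | base => simp [pathPerm, thetaTwist, hz, h1, thetaPathVertex_succ_ne_inl_false l i 0]
  | succ n hn ih => rw [pathPerm, hs n hn, ih, one_mul]

theorem dpColorFunction_generalizedTheta_lt {k : ℕ} (l : Fin k → ℕ) (hpos : ∀ i, 1 ≤ l i)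
    (i₀ : Fin k) (hmin : ∀ i, l i₀ ≤ l i) (i₁ : Fin k) (hne : i₁ ≠ i₀) (h2 : 2 ≤ l i₁)
    (hpar : Even (l i₀) ↔ Even (l i₁)) {m : ℕ} (hm : 2 * k + 3 ≤ m) :
    dpColorFunction (generalizedTheta l) m < chromaticCount (generalizedTheta l) m := by
  have hm3 : 3 ≤ m := by omega
  have hc : ∀ i, 0 < pathCoeff m (l i) := fun i => by
    obtain ⟨p, hp⟩ := Nat.exists_eq_add_of_le' (hpos i)
    rw [hp]; exact lt_of_lt_of_le one_pos (one_le_pathCoeff hm3 p)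
  obtain ⟨τ, hτ⟩ : ∃ τ : Equiv.Perm (Fin m), ∀ a, τ a ≠ a := by
    obtain ⟨p, rfl⟩ := Nat.exists_eq_add_of_le' (show 2 ≤ m by omega)
    exact ⟨Equiv.addRight 1, fun a => by simp⟩
  have hm0 : Nonempty (Fin m) := ⟨⟨0, by omega⟩⟩
  -- Length at least 2 gives path `i₁` an internal vertex, so its first edge can be twisted without
  -- affecting another path.
  have hw : 0 < l i₁ - 1 := by omega
  rw [chromaticCount_generalizedTheta]
  refine (dpColorFunction_generalizedTheta_le l (thetaTwist l (Sum.inr ⟨i₁, ⟨0, hw⟩⟩) τ)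
    (thetaTwist_symm l (by simp) τ)).trans_lt ?_
  rw [← Nat.cast_lt (α := ℚ), card_twistedThetaColoring l hpos hm3,
    card_twistedThetaColoring l hpos hm3]
  refine mul_lt_mul_of_pos_left (Finset.sum_lt_sum_of_nonempty Finset.univ_nonempty
    fun a _ => ?_) (Finset.prod_pos fun i _ => hc i)
  simp only [pathPerm_one, Equiv.Perm.one_apply]
  have he : ∀ i, pathPerm (fun j => thetaTwist l (Sum.inr ⟨i₁, ⟨0, hw⟩⟩) τ
      (thetaPathVertex l i j) (thetaPathVertex l i (j + 1))) (l i) a =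
      Function.update (fun _ => a) i₁ (τ a) i := by
    intro i
    rw [pathPerm_thetaTwist l τ i₁ hw i (hpos i)]
    by_cases hi : i = i₁
    · subst hi; simp
    · simp [hi]
  simp only [he]
  refine sum_prod_ite_update_lt (fun i => pathDeviation m (l i)) i₁ ?_ a (τ a) (hτ a)
  -- The remaining paths still include `i₀`, so their product deviates from 1 in the direction given
  -- by the parity of `l i₀`, which is that of `l i₁`.
  have hs := sign_prod_pathDeviation l hpos i₀ hmin hm (Finset.univ.erase i₁)
    (Finset.mem_erase.2 ⟨hne.symm, Finset.mem_univ _⟩)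
  have hd := neg_one_pow_mul_pathDeviation m (l i₀) (l i₁)
  rw [if_pos hpar] at hd
  have := mul_pos (hd ▸ one_div_pos.2 (hc i₁)) hs
  rcases neg_one_pow_eq_or ℚ (l i₀) with h | h <;> rw [h] at this <;> linarith

theorem theorem1p4 {V : Type*} [Fintype V] (G : SimpleGraph V) (k : ℕ) (hk : 2 ≤ k)
    (l : Fin k → ℕ) (hG : Nonempty (G ≃g generalizedTheta l))
    (hpos : ∀ i, 1 ≤ l i)
    (hmono : ∀ i j : Fin k, 1 ≤ i.val → i ≤ j → l i ≤ l j)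
    (hl : max (l ⟨0, by omega⟩) 2 ≤ l ⟨1, by omega⟩) :
    ((∃ j : Fin k, 1 ≤ j.val ∧ (Even (l ⟨0, by omega⟩) ↔ Even (l j))) →
      ∃ N : ℕ, ∀ m ≥ N, dpColorFunction G m < chromaticCount G m) ∧
    ((∀ j : Fin k, 1 ≤ j.val → ¬ (Even (l ⟨0, by omega⟩) ↔ Even (l j))) →
      ∃ N : ℕ, ∀ m ≥ N, dpColorFunction G m = chromaticCount G m) := by
  obtain ⟨e⟩ := hG
  simp only [dpColorFunction_congr e, chromaticCount_congr e]
  have hge : ∀ i : Fin k, 1 ≤ i.val → max (l ⟨0, by omega⟩) 2 ≤ l i := fun i hi =>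
    hl.trans (hmono _ _ le_rfl (Fin.le_def.2 hi))
  have hmin : ∀ i, l ⟨0, by omega⟩ ≤ l i := by
    intro i
    rcases Nat.eq_zero_or_pos i.val with h | h
    · exact le_of_eq (congrArg l (Fin.ext h.symm))
    · exact (le_max_left _ _).trans (hge i h)
  constructor
  · rintro ⟨j, hj, hpar⟩
    exact ⟨2 * k + 3, fun m hm => dpColorFunction_generalizedTheta_lt l hpos _ hmin j
      (fun h => by simp [h] at hj) ((le_max_right _ _).trans (hge j hj)) hpar hm⟩
  · intro hpar
    refine ⟨2 * k + 3, fun m hm => dpColorFunction_generalizedTheta_eq l hpos _ hmin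
      (fun j hj => hpar j ?_) hm⟩
    exact Nat.one_le_iff_ne_zero.2 fun h => hj (Fin.ext h)
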